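/- Let $\mathscr{C}$ be a (closed) model category with finite limits and colimits, with class $\mathcal{W}$ of weak equivalences, and suppose that functorial factorizations of every arrow as a cofibration followed by a trivial fibration, and as a trivial cofibration followed by a fibration, are given. Let $\mathscr{C}_{fc}$ be the full subcategory of fibrant-cofibrant objects, and $\mathcal{W}_{fc}=\mathcal{W}\cap\mathscr{C}_{fc}$. For an object $X$, let $QX$ be the middle object of the given factorization of $0\to X$ as a cofibration followed by a trivial fibration, and $RX$ the middle object of the given factorization of $X\to 1$ as a trivial cofibration followed by a fibration; by functoriality of the factorizations $Q$ and $R$ are functors $\mathscr{C}\to\mathscr{C}$, and $RQ$ takes values in $\mathscr{C}_{fc}$, so that it defines a functor $r:\mathscr{C}\to\mathscr{C}_{fc}$. The homotopy 2-category $\mathcal{H}o(\mathscr{C}_{fc})$ has the same objects and arrows as $\mathscr{C}_{fc}$. A cylinder for $X$ in $\mathscr{C}_{fc}$ consists of arrows $d_0,d_1:X\to W$, $s:W\to Z$, $x:X\to Z$ of $\mathscr{C}_{fc}$ with $s\in\mathcal{W}_{fc}$ and $sd_0=sd_1=x$; a homotopy $H$ from $f:X\to Y$ to $g:X\to Y$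 is such a cylinder with an arrow $h:W\to Y$ such that $hd_0=f$, $hd_1=g$. If $F:\mathscr{C}_{fc}\to\mathscr{D}$ is a 2-functor to a 2-category that sends $\mathcal{W}_{fc}$ to equivalences, let $\widehat{FC}:Fd_0\Rightarrow Fd_1$ be the unique 2-cell such that $Fs\,\widehat{FC}=\mathrm{id}_{Fx}$, and $\widehat{FH}=Fh\,\widehat{FC}:Ff\Rightarrow Fg$. The 2-cells $f\Rightarrow g$ of $\mathcal{H}o(\mathscr{C}_{fc})$ are the classes of finite sequences $(H_n,\dots,H_1)$ of composable homotopies from $f$ to $g$, where two sequences $(H_n,\dots,H_1)$ and $(K_m,\dots,K_1)$ are identified when $\widehat{FH_n}\circ\cdots\circ\widehat{FH_1}=\widehat{FK_m}\circ\cdots\circ\widehat{FK_1}$ for all such $\mathscr{D}$ and $F$; vertical composition is juxtaposition, and whiskering is given by composing homotopies with arrows. Let $i:\mathscr{C}_{fc}\to\mathcal{H}o(\mathscr{C}_{fc})$ be the inclusion and $q=i\,r:\mathscr{C}\to\mathcal{H}o(\mathscr{C}_{fc})$. For a 2-category $\mathscr{D}$, let $\pi_0\mathscr{D}$ be the category with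 the same objects whose arrows $X\to Y$ are the connected components of the category $\mathscr{D}(X,Y)$, and denote also by $\pi_0:\mathscr{D}\to\pi_0\mathscr{D}$ the canonical 2-functor. For a category $\mathscr{X}$ let $Hom(\mathscr{C},\mathscr{X})_+$ be the full subcategory of $Hom(\mathscr{C},\mathscr{X})$ of the functors that send weak equivalences to isomorphisms. Then the functor $\pi_0q:\mathscr{C}\to\pi_0\mathcal{H}o(\mathscr{C}_{fc})$ sends weak equivalences to isomorphisms, and for every category $\mathscr{X}$ the functor of precomposition $$(\pi_0q)^*:Hom(\pi_0\mathcal{H}o(\mathscr{C}_{fc}),\mathscr{X})\longrightarrow Hom(\mathscr{C},\mathscr{X})_+$$ is an equivalence of categories. Moreover, $\pi_0\mathcal{H}o(\mathscr{C}_{fc})$ is equivalent to Quillen's homotopy category: if $\gamma:\mathscr{C}\to\mathscr{C}[\mathcal{W}^{-1}]$ is the (strict) localization, there is an equivalence of categories $e:\mathscr{C}[\mathcal{W}^{-1}]\to\pi_0\mathcal{H}o(\mathscr{C}_{fc})$ with $e\,\gamma\cong\pi_0q$. -/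

import Mathlib

open CategoryTheory CategoryTheory.Limits HomotopicalAlgebra

universe v u v' u'

namespace TwoLoc

/-! ### Equivalences in a 2-category

A 2-category is a bicategory `D` with `Bicategory.Strict D`. -/

section Equivalences

open Bicategory

universe w₁ v₁ u₁

variable {D : Type u₁} [Bicategory.{w₁, v₁} D]

/-- An arrow of a 2-category is an equivalence if it has a quasi-inverse. -/
def IsEquivalenceArrow {a b : D} (f : a ⟶ b) : Prop :=
  ∃ g : b ⟶ a, Nonempty (𝟙 a ≅ f ≫ g) ∧ Nonempty (g ≫ f ≅ 𝟙 b)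

/-- Composing arrows with a fixed arrow that has a quasi-inverse is an equivalence of categories. -/
def postcompEquivalence (x : D) {a b : D} (f : a ⟶ b) (g : b ⟶ a)
    (η : 𝟙 a ≅ f ≫ g) (e : g ≫ f ≅ 𝟙 b) : (x ⟶ a) ≌ (x ⟶ b) :=
  CategoryTheory.Equivalence.mk (postcomp x f) (postcomp x g)
    (NatIso.ofComponents
      (fun k => (ρ_ k).symm ≪≫ whiskerLeftIso k η ≪≫ (α_ k f g).symm)
      (by
        intro k l φ
        change φ ≫ (ρ_ l).inv ≫ l ◁ η.hom ≫ (α_ l f g).inv =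
          ((ρ_ k).inv ≫ k ◁ η.hom ≫ (α_ k f g).inv) ≫ ((φ ▷ f) ▷ g)
        rw [Category.assoc, Category.assoc, rightUnitor_inv_naturality_assoc,
          ← whisker_exchange_assoc]
        simp))
    (NatIso.ofComponents
      (fun k => α_ k g f ≪≫ whiskerLeftIso k e ≪≫ ρ_ k)
      (by
        intro k l φ
        change ((φ ▷ g) ▷ f) ≫ (α_ l g f).hom ≫ l ◁ e.hom ≫ (ρ_ l).hom =
          ((α_ k g f).hom ≫ k ◁ e.hom ≫ (ρ_ k).hom) ≫ φ
        rw [Category.assoc, Category.assoc, ← rightUnitor_naturality, whisker_exchange_assoc]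
        simp))

/-- Whiskering with an equivalence is bijective on 2-cells. -/
theorem whiskerRight_bijective {x a b : D} {f : a ⟶ b} (hf : IsEquivalenceArrow f)
    (k l : x ⟶ a) : Function.Bijective (fun φ : k ⟶ l => φ ▷ f) := by
  obtain ⟨g, ⟨η⟩, ⟨e⟩⟩ := hf
  exact ((postcompEquivalence x f g η e).fullyFaithfulFunctor).map_bijective k l

end Equivalences

/-! ### Cylinders and homotopies -/

variable {A : Type u} [Category.{v} A] (W : MorphismProperty A)

/-- A cylinder for `X` with respect to a class `W` of arrows: arrows `d₀ d₁ : X ⟶ cyl`,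
`s : cyl ⟶ base` in `W` and `x : X ⟶ base`, such that `s d₀ = s d₁ = x`. -/
structure Cylinder (X : A) where
  cyl : A
  base : A
  d₀ : X ⟶ cyl
  d₁ : X ⟶ cyl
  s : cyl ⟶ base
  x : X ⟶ base
  hs : W s
  d₀_s : d₀ ≫ s = x
  d₁_s : d₁ ≫ s = x

/-- A (left) homotopy from `f` to `g`: a cylinder `C` and an arrow `h : C.cyl ⟶ Y` such that
`h d₀ = f` and `h d₁ = g`. -/
structure Homotopy {X Y : A} (f g : X ⟶ Y) where
  C : Cylinder W X
  h : C.cyl ⟶ Y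
  d₀_h : C.d₀ ≫ h = f
  d₁_h : C.d₁ ≫ h = g

/-- Finite sequences of composable homotopies. The empty sequence gives the identity 2-cell. -/
inductive HomotopySeq {X Y : A} : (X ⟶ Y) → (X ⟶ Y) → Type (max u v)
  | nil (f : X ⟶ Y) : HomotopySeq f f
  | cons {f g k : X ⟶ Y} (H : Homotopy W f g) (γ : HomotopySeq g k) : HomotopySeq f k

variable {W}

/-- The cylinder for `X'` obtained from a cylinder for `X` by composing with `l : X' ⟶ X`. -/
def Cylinder.precomp {X' X : A} (l : X' ⟶ X) (C : Cylinder W X) : Cylinder W X' where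
  cyl := C.cyl
  base := C.base
  d₀ := l ≫ C.d₀
  d₁ := l ≫ C.d₁
  s := C.s
  x := l ≫ C.x
  hs := C.hs
  d₀_s := by rw [Category.assoc, C.d₀_s]
  d₁_s := by rw [Category.assoc, C.d₁_s]

/-- The homotopy `H l`. -/
def Homotopy.precomp {X' X Y : A} (l : X' ⟶ X) {f g : X ⟶ Y} (H : Homotopy W f g) :
    Homotopy W (l ≫ f) (l ≫ g) where
  C := H.C.precomp l
  h := H.h
  d₀_h := (Category.assoc _ _ _).trans (congrArg (l ≫ ·) H.d₀_h)
  d₁_h := (Category.assoc _ _ _).trans (congrArg (l ≫ ·) H.d₁_h)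

/-- The homotopy `r H`. -/
def Homotopy.postcomp {X Y Y' : A} {f g : X ⟶ Y} (H : Homotopy W f g) (r : Y ⟶ Y') :
    Homotopy W (f ≫ r) (g ≫ r) where
  C := H.C
  h := H.h ≫ r
  d₀_h := by rw [← Category.assoc, H.d₀_h]
  d₁_h := by rw [← Category.assoc, H.d₁_h]

namespace HomotopySeq

/-- Juxtaposition of sequences. -/
def append {X Y : A} {f g k : X ⟶ Y} : HomotopySeq W f g → HomotopySeq W g k → HomotopySeq W f k
  | nil _, δ => δ
  | cons H γ, δ => cons H (append γ δ)

def precomp {X' X Y : A} (l : X' ⟶ X) {f g : X ⟶ Y} :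
    HomotopySeq W f g → HomotopySeq W (l ≫ f) (l ≫ g)
  | nil f => nil (l ≫ f)
  | cons H γ => cons (H.precomp l) (precomp l γ)

def postcomp {X Y Y' : A} {f g : X ⟶ Y} (r : Y ⟶ Y') :
    HomotopySeq W f g → HomotopySeq W (f ≫ r) (g ≫ r)
  | nil f => nil (f ≫ r)
  | cons H γ => cons (H.postcomp r) (postcomp r γ)

end HomotopySeq

/-! ### The 2-cells induced in a 2-category by homotopies

A 2-functor from the category `A` (seen as a 2-category with only identity 2-cells) to a
2-category `D` is the same thing as a functor from `A` to the underlying category of `D`. -/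

section Hat

open Bicategory

universe w₁ v₁ u₁

variable {D : Type u₁} [Bicategory.{w₁, v₁} D] [Strict D]

/-- The 2-functor `F` sends the members of `W` to equivalences. -/
def SendsToEquivalences (W : MorphismProperty A) (F : A ⥤ D) : Prop :=
  ∀ ⦃X Y : A⦄ (s : X ⟶ Y), W s → IsEquivalenceArrow (D := D) (F.map s)

variable (F : A ⥤ D) (hF : SendsToEquivalences W F)

/-- In `D`, there is a unique 2-cell `θ : F d₀ ⟹ F d₁` such that `(F s) θ` is the identity of
`F x`. -/
theorem existsUnique_hat (F : A ⥤ D) (hF : SendsToEquivalences W F) {X : A} (C : Cylinder W X) :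
    ∃! θ : (F.map C.d₀ : F.obj X ⟶ F.obj C.cyl) ⟶ F.map C.d₁,
      θ ▷ F.map C.s = eqToHom (by
        rw [← F.map_comp, ← F.map_comp, C.d₀_s, C.d₁_s]) :=
  (whiskerRight_bijective (hF C.s C.hs) _ _).existsUnique _

/-- The 2-cell `F d₀ ⟹ F d₁` induced by a cylinder. -/
noncomputable def hatCylinder {X : A} (C : Cylinder W X) :
    (F.map C.d₀ : F.obj X ⟶ F.obj C.cyl) ⟶ F.map C.d₁ :=
  (existsUnique_hat F hF C).choose

/-- The 2-cell `F f ⟹ F g` induced by a homotopy from `f` to `g`. -/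
noncomputable def hatHomotopy {X Y : A} {f g : X ⟶ Y} (H : Homotopy W f g) :
    (F.map f : F.obj X ⟶ F.obj Y) ⟶ F.map g :=
  eqToHom (by rw [← F.map_comp, H.d₀_h]) ≫ hatCylinder F hF H.C ▷ F.map H.h ≫
    eqToHom (by rw [← F.map_comp, H.d₁_h])

/-- The vertical composite of the 2-cells induced by a sequence of homotopies. -/
noncomputable def hatSeq {X Y : A} {f g : X ⟶ Y} : HomotopySeq W f g →
    ((F.map f : F.obj X ⟶ F.obj Y) ⟶ F.map g)
  | HomotopySeq.nil f => 𝟙 _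
  | HomotopySeq.cons H γ => hatHomotopy F hF H ≫ hatSeq γ

theorem hatCylinder_spec {X : A} (C : Cylinder W X) :
    hatCylinder F hF C ▷ F.map C.s = eqToHom (by
        rw [← F.map_comp, ← F.map_comp, C.d₀_s, C.d₁_s]) :=
  (existsUnique_hat F hF C).choose_spec.1

theorem hatCylinder_unique {X : A} (C : Cylinder W X)
    (θ : (F.map C.d₀ : F.obj X ⟶ F.obj C.cyl) ⟶ F.map C.d₁)
    (h : θ ▷ F.map C.s = eqToHom (by
        rw [← F.map_comp, ← F.map_comp, C.d₀_s, C.d₁_s])) :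
    hatCylinder F hF C = θ :=
  (existsUnique_hat F hF C).unique (hatCylinder_spec F hF C) h

theorem whiskerLeft_aux {a b c d : D} {l : a ⟶ b} {d₀ d₁ : b ⟶ c} (θ : d₀ ⟶ d₁) {s : c ⟶ d}
    {h : d₀ ≫ s = d₁ ≫ s} (hθ : θ ▷ s = eqToHom h) {p₀ p₁ : a ⟶ c} (h₀ : p₀ = l ≫ d₀)
    (h₁ : p₁ = l ≫ d₁) (h' : p₀ ≫ s = p₁ ≫ s) :
    (eqToHom h₀ ≫ l ◁ θ ≫ eqToHom h₁.symm) ▷ s = eqToHom h' := by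
  subst h₀ h₁
  simp [hθ, Strict.associator_eqToIso]

theorem whisker_aux {a b c d : D} {l : a ⟶ b} {d₀ d₁ : b ⟶ c} (θ : d₀ ⟶ d₁) {h : c ⟶ d}
    {p₀ p₁ : a ⟶ c} (h₀ : p₀ = l ≫ d₀) (h₁ : p₁ = l ≫ d₁) {f g : b ⟶ d} (hf : f = d₀ ≫ h)
    (hg : d₁ ≫ h = g) {f' g' : a ⟶ d} (hf' : f' = p₀ ≫ h) (hg' : p₁ ≫ h = g')
    (k : f' = l ≫ f) (k' : l ≫ g = g') :
    eqToHom hf' ≫ (eqToHom h₀ ≫ l ◁ θ ≫ eqToHom h₁.symm) ▷ h ≫ eqToHom hg' =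
      eqToHom k ≫ l ◁ (eqToHom hf ≫ θ ▷ h ≫ eqToHom hg) ≫ eqToHom k' := by
  subst h₀ h₁ hf hg hf' hg'
  simp [Strict.associator_eqToIso]

theorem whiskerRight_aux {a b c d : D} {d₀ d₁ : a ⟶ b} (θ : d₀ ⟶ d₁) {h : b ⟶ c} {r : c ⟶ d}
    {hr : b ⟶ d} (e : hr = h ≫ r) {f g : a ⟶ c} (hf : f = d₀ ≫ h) (hg : d₁ ≫ h = g)
    {f' g' : a ⟶ d} (hf' : f' = d₀ ≫ hr) (hg' : d₁ ≫ hr = g') (k : f' = f ≫ r)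
    (k' : g ≫ r = g') :
    eqToHom hf' ≫ θ ▷ hr ≫ eqToHom hg' =
      eqToHom k ≫ (eqToHom hf ≫ θ ▷ h ≫ eqToHom hg) ▷ r ≫ eqToHom k' := by
  subst e hf hg hf' hg'
  simp [Strict.associator_eqToIso]

theorem id_whiskerLeft_aux {a b : D} {i : a ⟶ a} (hi : i = 𝟙 a) {f g : a ⟶ b} (θ : f ⟶ g)
    {f' g' : a ⟶ b} (hf : f' = i ≫ f) (hg : i ≫ g = g') (k : f' = f) (k' : g = g') :
    eqToHom hf ≫ i ◁ θ ≫ eqToHom hg = eqToHom k ≫ θ ≫ eqToHom k' := by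
  subst hi hg k
  simp [Strict.leftUnitor_eqToIso]

theorem whiskerRight_id_aux {a b : D} {i : b ⟶ b} (hi : i = 𝟙 b) {f g : a ⟶ b} (θ : f ⟶ g)
    {f' g' : a ⟶ b} (hf : f' = f ≫ i) (hg : g ≫ i = g') (k : f' = f) (k' : g = g') :
    eqToHom hf ≫ θ ▷ i ≫ eqToHom hg = eqToHom k ≫ θ ≫ eqToHom k' := by
  subst hi hg k
  simp [Strict.rightUnitor_eqToIso]

theorem comp_whiskerLeft_aux {a b c d : D} {l : a ⟶ b} {m : b ⟶ c} {n : a ⟶ c} (e : n = l ≫ m)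
    {f g : c ⟶ d} (θ : f ⟶ g) {f' g' : a ⟶ d} (hf : f' = n ≫ f) (hg : n ≫ g = g')
    (k : f' = l ≫ m ≫ f) (k' : l ≫ m ≫ g = g') :
    eqToHom hf ≫ n ◁ θ ≫ eqToHom hg = eqToHom k ≫ l ◁ m ◁ θ ≫ eqToHom k' := by
  subst e hf hg
  simp [Strict.associator_eqToIso]

theorem whiskerRight_comp_aux {a b c d : D} {l : b ⟶ c} {m : c ⟶ d} {n : b ⟶ d} (e : n = l ≫ m)
    {f g : a ⟶ b} (θ : f ⟶ g) {f' g' : a ⟶ d} (hf : f' = f ≫ n) (hg : g ≫ n = g')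
    (k : f' = (f ≫ l) ≫ m) (k' : (g ≫ l) ≫ m = g') :
    eqToHom hf ≫ θ ▷ n ≫ eqToHom hg = eqToHom k ≫ (θ ▷ l) ▷ m ≫ eqToHom k' := by
  subst e hf hg
  simp [Strict.associator_eqToIso]

theorem whisker_exchange_aux {a b c : D} {f g : a ⟶ b} (θ : f ⟶ g) {f' g' : b ⟶ c}
    (θ' : f' ⟶ g') {s t : a ⟶ c} (p : s = f ≫ f') (p' : g ≫ g' = t) :
    eqToHom p ≫ f ◁ θ' ≫ θ ▷ g' ≫ eqToHom p' =
      eqToHom p ≫ θ ▷ f' ≫ g ◁ θ' ≫ eqToHom p' := by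
  rw [whisker_exchange_assoc]

theorem hatCylinder_precomp {X' X : A} (l : X' ⟶ X) (C : Cylinder W X) :
    hatCylinder F hF (C.precomp l) =
      eqToHom (F.map_comp l C.d₀) ≫ F.map l ◁ hatCylinder F hF C ≫
        eqToHom (F.map_comp l C.d₁).symm := by
  apply hatCylinder_unique
  exact whiskerLeft_aux (D := D) _ (hatCylinder_spec F hF C) (F.map_comp l C.d₀)
    (F.map_comp l C.d₁) _

theorem hatHomotopy_precomp {X' X Y : A} (l : X' ⟶ X) {f g : X ⟶ Y} (H : Homotopy W f g) :
    hatHomotopy F hF (H.precomp l) =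
      eqToHom (F.map_comp l f) ≫ F.map l ◁ hatHomotopy F hF H ≫
        eqToHom (F.map_comp l g).symm := by
  unfold hatHomotopy
  change _ ≫ hatCylinder F hF (H.C.precomp l) ▷ F.map H.h ≫ _ = _
  rw [hatCylinder_precomp]
  exact whisker_aux (D := D) _ (F.map_comp l H.C.d₀) (F.map_comp l H.C.d₁) _ _ _ _ _ _

theorem hatHomotopy_postcomp {X Y Y' : A} {f g : X ⟶ Y} (H : Homotopy W f g) (r : Y ⟶ Y') :
    hatHomotopy F hF (H.postcomp r) =
      eqToHom (F.map_comp f r) ≫ hatHomotopy F hF H ▷ F.map r ≫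
        eqToHom (F.map_comp g r).symm := by
  exact whiskerRight_aux (D := D) (hatCylinder F hF H.C) (F.map_comp H.h r) _ _ _ _ _ _

theorem hatSeq_append {X Y : A} {f g k : X ⟶ Y} (γ : HomotopySeq W f g)
    (δ : HomotopySeq W g k) :
    hatSeq F hF (γ.append δ) = hatSeq F hF γ ≫ hatSeq F hF δ := by
  induction γ with
  | nil f => simp [HomotopySeq.append, hatSeq]
  | cons H γ ih => simp [HomotopySeq.append, hatSeq, ih]

theorem hatSeq_precomp {X' X Y : A} (l : X' ⟶ X) {f g : X ⟶ Y} (γ : HomotopySeq W f g) :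
    hatSeq F hF (γ.precomp l) =
      eqToHom (F.map_comp l f) ≫ F.map l ◁ hatSeq F hF γ ≫ eqToHom (F.map_comp l g).symm := by
  induction γ with
  | nil f => simp [HomotopySeq.precomp, hatSeq]
  | cons H γ ih => simp [HomotopySeq.precomp, hatSeq, ih, hatHomotopy_precomp]

theorem hatSeq_postcomp {X Y Y' : A} {f g : X ⟶ Y} (r : Y ⟶ Y') (γ : HomotopySeq W f g) :
    hatSeq F hF (γ.postcomp r) =
      eqToHom (F.map_comp f r) ≫ hatSeq F hF γ ▷ F.map r ≫ eqToHom (F.map_comp g r).symm := by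
  induction γ with
  | nil f => simp [HomotopySeq.postcomp, hatSeq]
  | cons H γ ih => simp [HomotopySeq.postcomp, hatSeq, ih, hatHomotopy_postcomp]

end Hat

/-! ### The homotopy 2-category -/

/-- Two sequences of homotopies are equivalent if every 2-functor from `A` to a 2-category that
sends `W` to equivalences gives them the same 2-cell. (The sub-2-category generated by the image
of `A`, together with the chosen quasi-inverses and invertible 2-cells, lives in the universe
`max u v`, so that 2-categories `D` in larger universes give the same relation.) -/
def AdHoc {X Y : A} {f g : X ⟶ Y} (γ δ : HomotopySeq W f g) : Prop :=
  ∀ (D : Type (max u v)) [Bicategory.{max u v, max u v} D] [Bicategory.Strict D]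
    (F : A ⥤ D) (hF : SendsToEquivalences W F), hatSeq F hF γ = hatSeq F hF δ

variable (W) in
def adHocSetoid {X Y : A} (f g : X ⟶ Y) : Setoid (HomotopySeq W f g) where
  r := AdHoc
  iseqv :=
    { refl := fun _ _ _ _ _ _ => rfl
      symm := fun h D _ _ F hF => (h D F hF).symm
      trans := fun h h' D _ _ F hF => (h D F hF).trans (h' D F hF) }

/-- The objects of the homotopy 2-category of `A` with respect to `W` are those of `A`. -/
structure Ho (W : MorphismProperty A) where
  as : A

namespace Ho

/-- The arrows of the homotopy 2-category are those of `A`. -/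
@[ext]
structure Hom (X Y : Ho W) where
  as : X.as ⟶ Y.as

instance : CategoryStruct (Ho W) where
  Hom X Y := Hom X Y
  id X := ⟨𝟙 X.as⟩
  comp f g := ⟨f.as ≫ g.as⟩

theorem hom_ext {X Y : Ho W} {f g : X ⟶ Y} (h : f.as = g.as) : f = g := Hom.ext h

/-- The 2-cells are the classes of sequences of homotopies, with juxtaposition as vertical
composition. -/
instance (X Y : Ho W) : Category (X ⟶ Y) where
  Hom f g := Quotient (adHocSetoid W f.as g.as)
  id f := Quotient.mk _ (HomotopySeq.nil f.as)
  comp := Quotient.map₂ HomotopySeq.append (by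
    intro γ γ' h δ δ' h' D _ _ F hF
    rw [hatSeq_append, hatSeq_append, h D F hF, h' D F hF])
  id_comp := by
    rintro f g ⟨γ⟩
    rfl
  comp_id := by
    rintro f g ⟨γ⟩
    apply Quotient.sound
    intro D _ _ F hF
    rw [hatSeq_append]
    exact Category.comp_id _
  assoc := by
    rintro f g k l ⟨γ⟩ ⟨δ⟩ ⟨e⟩
    apply Quotient.sound
    intro D _ _ F hF
    simp only [hatSeq_append, Category.assoc]

section Ev

variable {D : Type (max u v)} [Bicategory.{max u v, max u v} D] [Bicategory.Strict D]
  (F : A ⥤ D) (hF : SendsToEquivalences W F)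

/-- The 2-cell of `D` given by a 2-cell of the homotopy 2-category. -/
noncomputable def ev {X Y : Ho W} {f g : X ⟶ Y} (φ : f ⟶ g) :
    (F.map f.as : F.obj X.as ⟶ F.obj Y.as) ⟶ F.map g.as :=
  Quotient.lift (s := adHocSetoid W f.as g.as) (hatSeq F hF) (fun _ _ h => h D F hF) φ

@[simp]
theorem ev_id {X Y : Ho W} (f : X ⟶ Y) : ev F hF (𝟙 f) = 𝟙 _ := rfl

@[simp]
theorem ev_comp {X Y : Ho W} {f g k : X ⟶ Y} (φ : f ⟶ g) (ψ : g ⟶ k) :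
    ev F hF (φ ≫ ψ) = ev F hF φ ≫ ev F hF ψ := by
  induction φ using Quotient.inductionOn
  induction ψ using Quotient.inductionOn
  exact hatSeq_append F hF _ _

@[simp]
theorem ev_eqToHom {X Y : Ho W} {f g : X ⟶ Y} (h : f = g) :
    ev F hF (eqToHom h) = eqToHom (by rw [h]) := by
  subst h; rfl

end Ev

theorem ev_ext {X Y : Ho W} {f g : X ⟶ Y} {φ ψ : f ⟶ g}
    (h : ∀ (D : Type (max u v)) [Bicategory.{max u v, max u v} D] [Bicategory.Strict D]
      (F : A ⥤ D) (hF : SendsToEquivalences W F), ev F hF φ = ev F hF ψ) : φ = ψ := by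
  induction φ using Quotient.inductionOn
  induction ψ using Quotient.inductionOn
  exact Quotient.sound h

/-- The 2-cell `[H] l`. -/
def precomp {X' X Y : Ho W} (l : X' ⟶ X) {f g : X ⟶ Y} (φ : f ⟶ g) : l ≫ f ⟶ l ≫ g :=
  Quotient.map (sa := adHocSetoid W f.as g.as) (sb := adHocSetoid W (l ≫ f).as (l ≫ g).as)
    (HomotopySeq.precomp l.as) (by
      intro γ γ' h D _ _ F hF
      change hatSeq F hF (γ.precomp l.as) = hatSeq F hF (γ'.precomp l.as)
      rw [hatSeq_precomp, hatSeq_precomp, h D F hF]) φ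

/-- The 2-cell `r [H]`. -/
def postcomp {X Y Y' : Ho W} {f g : X ⟶ Y} (φ : f ⟶ g) (r : Y ⟶ Y') : f ≫ r ⟶ g ≫ r :=
  Quotient.map (sa := adHocSetoid W f.as g.as) (sb := adHocSetoid W (f ≫ r).as (g ≫ r).as)
    (HomotopySeq.postcomp r.as) (by
      intro γ γ' h D _ _ F hF
      change hatSeq F hF (γ.postcomp r.as) = hatSeq F hF (γ'.postcomp r.as)
      rw [hatSeq_postcomp, hatSeq_postcomp, h D F hF]) φ

section Ev

open Bicategory

variable {D : Type (max u v)} [Bicategory.{max u v, max u v} D] [Bicategory.Strict D]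
  (F : A ⥤ D) (hF : SendsToEquivalences W F)

@[simp]
theorem ev_precomp {X' X Y : Ho W} (l : X' ⟶ X) {f g : X ⟶ Y} (φ : f ⟶ g) :
    ev F hF (precomp l φ) =
      eqToHom (F.map_comp l.as f.as) ≫ F.map l.as ◁ ev F hF φ ≫
        eqToHom (F.map_comp l.as g.as).symm := by
  induction φ using Quotient.inductionOn
  exact hatSeq_precomp F hF _ _

@[simp]
theorem ev_postcomp {X Y Y' : Ho W} {f g : X ⟶ Y} (φ : f ⟶ g) (r : Y ⟶ Y') :
    ev F hF (postcomp φ r) =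
      eqToHom (F.map_comp f.as r.as) ≫ ev F hF φ ▷ F.map r.as ≫
        eqToHom (F.map_comp g.as r.as).symm := by
  induction φ using Quotient.inductionOn
  exact hatSeq_postcomp F hF _ _

end Ev

/-- The homotopy 2-category. -/
instance : Bicategory (Ho W) where
  whiskerLeft l _ _ φ := precomp l φ
  whiskerRight φ r := postcomp φ r
  associator f g h := eqToIso (hom_ext (Category.assoc _ _ _))
  leftUnitor f := eqToIso (hom_ext (Category.id_comp _))
  rightUnitor f := eqToIso (hom_ext (Category.comp_id _))
  whiskerLeft_id := by
    intros; apply ev_ext; intro D _ _ F hF; simp; rfl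
  whiskerLeft_comp := by
    intros; apply ev_ext; intros; simp
  id_whiskerLeft := by
    intros; apply ev_ext; intro D _ _ F hF; simp
    exact id_whiskerLeft_aux (D := D) (F.map_id _) _ _ _ _ _
  comp_whiskerLeft := by
    intros; apply ev_ext; intro D _ _ F hF; simp
    exact comp_whiskerLeft_aux (D := D) (F.map_comp _ _) _ _ _ _ _
  id_whiskerRight := by
    intros; apply ev_ext; intro D _ _ F hF; simp; rfl
  comp_whiskerRight := by
    intros; apply ev_ext; intros; simp
  whiskerRight_id := by
    intros; apply ev_ext; intro D _ _ F hF; simp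
    exact whiskerRight_id_aux (D := D) (F.map_id _) _ _ _ _ _
  whiskerRight_comp := by
    intros; apply ev_ext; intro D _ _ F hF; simp
    exact whiskerRight_comp_aux (D := D) (F.map_comp _ _) _ _ _ _ _
  whisker_assoc := by
    intros; apply ev_ext; intro D _ _ F hF; simp [Bicategory.Strict.associator_eqToIso]
  whisker_exchange := by
    intros; apply ev_ext; intro D _ _ F hF; simp
    exact whisker_exchange_aux (D := D) _ _ _ _
  pentagon := by
    intros; apply ev_ext; intros; simp
  triangle := by
    intros; apply ev_ext; intros; simp

instance : Bicategory.Strict (Ho W) where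
  id_comp _ := hom_ext (Category.id_comp _)
  comp_id _ := hom_ext (Category.comp_id _)
  assoc _ _ _ := hom_ext (Category.assoc _ _ _)

variable (W) in
/-- The inclusion 2-functor `A ⟶ Ho W`, the identity on objects and arrows. -/
def incl : A ⥤ Ho W where
  obj X := ⟨X⟩
  map f := (⟨f⟩ : Hom _ _)

end Ho

/-! ### Connected components of the hom-categories -/

section PiZero

open Bicategory

universe w₁ v₁ u₁

/-- The objects of `π₀ D` are those of `D`. -/
structure PiZero (D : Type u₁) where
  as : D

variable (D : Type u₁) [Bicategory.{w₁, v₁} D]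

/-- The arrows of `π₀ D` are the connected components of the hom-categories of `D`. -/
instance : Category (PiZero D) where
  Hom X Y := CategoryTheory.ConnectedComponents (X.as ⟶ Y.as)
  id X := Quotient.mk (Zigzag.setoid _) (𝟙 X.as)
  comp {X Y Z} := Quotient.map₂ (fun (f : X.as ⟶ Y.as) (g : Y.as ⟶ Z.as) => f ≫ g) (by
    intro f f' hf g g' hg
    exact (zigzag_obj_of_zigzag (Bicategory.postcomp X.as g) hf).trans
      (zigzag_obj_of_zigzag (Bicategory.precomp Z.as f') hg))
  id_comp := by
    rintro X Y ⟨f⟩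
    exact Quotient.sound (s := Zigzag.setoid _) (Zigzag.of_hom (λ_ f).hom)
  comp_id := by
    rintro X Y ⟨f⟩
    exact Quotient.sound (s := Zigzag.setoid _) (Zigzag.of_hom (ρ_ f).hom)
  assoc := by
    rintro X Y Z T ⟨f⟩ ⟨g⟩ ⟨h⟩
    exact Quotient.sound (s := Zigzag.setoid _) (Zigzag.of_hom (α_ f g h).hom)

/-- The 2-functor from a 2-category `D` to the category `π₀ D`, on underlying categories. -/
def toPiZero [Strict D] : D ⥤ PiZero D where
  obj X := ⟨X⟩
  map f := Quotient.mk (Zigzag.setoid _) f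

end PiZero

/-! ### Model categories with functorial factorizations -/

section Model

variable {C : Type u} [Category.{v} C] [ModelCategory C]

/-- The functor sending `X` to the arrow `⊥_ C ⟶ X` and `f` to `(id, f)`. -/
noncomputable def initialArrow : C ⥤ Arrow C where
  obj X := Arrow.mk (initial.to X)
  map {X Y} f := Arrow.homMk (𝟙 (⊥_ C)) f (initial.hom_ext _ _)
  map_id X := by ext <;> simp
  map_comp f g := by ext <;> simp

/-- The functor sending `X` to the arrow `X ⟶ ⊤_ C` and `f` to `(f, id)`. -/
noncomputable def terminalArrow : C ⥤ Arrow C where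
  obj X := Arrow.mk (terminal.from X)
  map {X Y} f := Arrow.homMk f (𝟙 (⊤_ C)) (terminal.hom_ext _ _)
  map_id X := by ext <;> simp
  map_comp f g := by ext <;> simp

/-- The cofibrant replacement functor: `Q X` is the middle object of the functorial factorization
of `⊥_ C ⟶ X` as a cofibration followed by a trivial fibration, and `Q f = F (id, f)`. -/
noncomputable def cofibrantReplacement
    (φ : MorphismProperty.FunctorialFactorizationData (cofibrations C) (trivialFibrations C)) :
    C ⥤ C :=
  initialArrow ⋙ φ.Z

/-- The fibrant replacement functor: `R X` is the middle object of the functorial factorization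
of `X ⟶ ⊤_ C` as a trivial cofibration followed by a fibration, and `R f = F (f, id)`. -/
noncomputable def fibrantReplacement
    (ψ : MorphismProperty.FunctorialFactorizationData (trivialCofibrations C) (fibrations C)) :
    C ⥤ C :=
  terminalArrow ⋙ ψ.Z

variable
  (φ : MorphismProperty.FunctorialFactorizationData (cofibrations C) (trivialFibrations C))
  (ψ : MorphismProperty.FunctorialFactorizationData (trivialCofibrations C) (fibrations C))

theorem bifibrant_replacement (X : C) :
    bifibrantObjects C ((cofibrantReplacement φ ⋙ fibrantReplacement ψ).obj X) := by
  let i₁ : ⊥_ C ⟶ (cofibrantReplacement φ).obj X := φ.i.app (Arrow.mk (initial.to X))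
  let i₂ : (cofibrantReplacement φ).obj X ⟶
      (cofibrantReplacement φ ⋙ fibrantReplacement ψ).obj X :=
    ψ.i.app (Arrow.mk (terminal.from ((cofibrantReplacement φ).obj X)))
  let p₂ : (cofibrantReplacement φ ⋙ fibrantReplacement ψ).obj X ⟶ ⊤_ C :=
    ψ.p.app (Arrow.mk (terminal.from ((cofibrantReplacement φ).obj X)))
  have h₁ : Cofibration i₁ := (cofibration_iff _).2 (φ.hi _)
  have h₂ : Cofibration i₂ := (cofibration_iff _).2 (ψ.hi _).1
  have h₃ : Fibration p₂ := (fibration_iff _).2 (ψ.hp _)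
  exact ⟨(isCofibrant_iff_of_isInitial (i₁ ≫ i₂) initialIsInitial).2 inferInstance,
    (isFibrant_iff_of_isTerminal p₂ terminalIsTerminal).2 h₃⟩

/-- The fibrant-cofibrant replacement functor `r : C ⟶ C_fc`, given by `R Q`. -/
noncomputable def bifibrantReplacement : C ⥤ BifibrantObject C :=
  ObjectProperty.lift _ (cofibrantReplacement φ ⋙ fibrantReplacement ψ)
    (bifibrant_replacement φ ψ)

variable (C) in
/-- The weak equivalences between fibrant-cofibrant objects. -/
abbrev bifibrantWeakEquivalences : MorphismProperty (BifibrantObject C) :=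
  (weakEquivalences C).inverseImage BifibrantObject.ι

/-- The 2-functor `q : C ⟶ Ho(C_fc)`. -/
noncomputable def locFunctor : C ⥤ Ho (bifibrantWeakEquivalences C) :=
  bifibrantReplacement φ ψ ⋙ Ho.incl (bifibrantWeakEquivalences C)

/-- The functor `π₀ q : C ⟶ π₀ Ho(C_fc)`. -/
noncomputable def piZeroLocFunctor : C ⥤ PiZero (Ho (bifibrantWeakEquivalences C)) :=
  locFunctor φ ψ ⋙ toPiZero (Ho (bifibrantWeakEquivalences C))

end Model

section Precomposition

universe v₁ u₁ v₂ u₂ v₃ u₃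

/-- If `L` sends the arrows in `W` to isomorphisms, precomposition with `L` is a functor from
`Hom(B, X)` to the full subcategory `Hom(A, X)_+` of `Hom(A, X)` of the functors that send the
arrows in `W` to isomorphisms. -/
def precompInverting {A : Type u₁} [Category.{v₁} A] {B : Type u₂} [Category.{v₂} B]
    (L : A ⥤ B) (W : MorphismProperty A) (hL : W.IsInvertedBy L)
    (X : Type u₃) [Category.{v₃} X] : (B ⥤ X) ⥤ W.FunctorsInverting X :=
  ObjectProperty.lift _ ((Functor.whiskeringLeft A B X).obj L)
    (fun G => MorphismProperty.IsInvertedBy.of_comp W L hL G)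

end Precomposition

end TwoLoc

/-! After applying `π₀`, only the existence of a 2-cell between two arrows matters, not the
identifications imposed on sequences of homotopies. So `π₀ Ho(A)` is `A` with `f` and `g` identified
whenever a zigzag of homotopies joins them. A functor inverting `W` equalizes the two ends `d₀`,
`d₁` of every cylinder, because `s` becomes invertible, and therefore factors uniquely through `A ⥤
π₀ Ho(A)`. For any class `W`, this functor is thus a localization as soon as it inverts `W` itself
(`isLocalization_inclPiZero`).

For `A = C_fc` this last condition is a Whitehead theorem: weak equivalences between
fibrant-cofibrant objects are homotopy equivalences (`inclPiZero_inverts`). Finally `C_fc` and `C`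
have the same localization, and the zigzag `X ⟵ QX ⟶ RQX` of weak equivalences identifies the
localization functor of `C` with `π₀ q` up to an equivalence of targets. Every claim of the theorem
is then a formal property of localization functors. -/

namespace TwoLoc

/-! ### The localization of `A` at `W` and homotopies -/

section PiZeroHo

variable {A : Type u} [Category.{v} A] {W : MorphismProperty A}

/-- Homotopic arrows become equal when the members of `W` are inverted. -/
theorem Homotopy.map_eq {E : Type*} [Category* E] {F : A ⥤ E} (hF : W.IsInvertedBy F)
    {X Y : A} {f g : X ⟶ Y} (H : Homotopy W f g) : F.map f = F.map g := by
  have := hF H.C.s H.C.hs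
  have h : F.map H.C.d₀ = F.map H.C.d₁ := by
    rw [← cancel_mono (F.map H.C.s), ← F.map_comp, ← F.map_comp, H.C.d₀_s, H.C.d₁_s]
  calc
    F.map f = F.map H.C.d₀ ≫ F.map H.h := by rw [← F.map_comp, H.d₀_h]
    _ = F.map H.C.d₁ ≫ F.map H.h := by rw [h]
    _ = F.map g := by rw [← F.map_comp, H.d₁_h]

theorem HomotopySeq.map_eq {E : Type*} [Category* E] {F : A ⥤ E} (hF : W.IsInvertedBy F)
    {X Y : A} {f g : X ⟶ Y} (γ : HomotopySeq W f g) : F.map f = F.map g := by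
  induction γ with
  | nil f => rfl
  | cons H γ ih => exact (H.map_eq hF).trans ih

/-- The conclusion depends only on the endpoints of the 2-cell, so any representing sequence will do
and the relation `AdHoc` plays no role. -/
theorem Ho.map_eq {E : Type*} [Category* E] {F : A ⥤ E} (hF : W.IsInvertedBy F)
    {X Y : Ho W} {f g : X ⟶ Y} (θ : f ⟶ g) : F.map f.as = F.map g.as := by
  induction θ using Quotient.inductionOn with
  | _ γ => exact γ.map_eq hF

/-- This is what makes `liftPiZero` well defined on connected components. -/
theorem Ho.map_eq_of_zigzag {E : Type*} [Category* E] {F : A ⥤ E} (hF : W.IsInvertedBy F)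
    {X Y : Ho W} {f g : X ⟶ Y} (h : Zigzag f g) : F.map f.as = F.map g.as := by
  induction h with
  | refl => rfl
  | tail _ h ih =>
    obtain ⟨⟨θ⟩⟩ | ⟨⟨θ⟩⟩ := h
    · exact ih.trans (Ho.map_eq hF θ)
    · exact ih.trans (Ho.map_eq hF θ).symm

variable (W) in
/-- The canonical functor from `A` to `π₀ Ho(A)`. -/
def inclPiZero : A ⥤ PiZero (Ho W) :=
  Ho.incl W ⋙ toPiZero (Ho W)

theorem Homotopy.inclPiZero_map_eq {X Y : A} {f g : X ⟶ Y} (H : Homotopy W f g) :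
    (inclPiZero W).map f = (inclPiZero W).map g :=
  Quotient.sound (s := Zigzag.setoid _) (Zigzag.of_hom
    (show (Ho.incl W).map f ⟶ (Ho.incl W).map g from
      Quotient.mk (adHocSetoid W f g) (.cons H (.nil g))))

/-- The functor on `π₀ Ho(A)` induced by a functor which inverts `W`. -/
def liftPiZero {E : Type*} [Category* E] (F : A ⥤ E) (hF : W.IsInvertedBy F) :
    PiZero (Ho W) ⥤ E where
  obj X := F.obj X.as.as
  map {X Y} f := Quotient.lift (s := Zigzag.setoid _) (fun f : X.as ⟶ Y.as => F.map f.as)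
    (fun _ _ h => Ho.map_eq_of_zigzag hF h) f
  map_id X := F.map_id X.as.as
  map_comp := by
    rintro X Y Z ⟨f⟩ ⟨g⟩
    exact F.map_comp f.as g.as

/-- If `A ⥤ π₀ Ho(A)` inverts `W`, it satisfies the strict universal property of the
localization. -/
def strictUniversalPropertyInclPiZero (hW : W.IsInvertedBy (inclPiZero W)) (E : Type*)
    [Category* E] : Localization.StrictUniversalPropertyFixedTarget (inclPiZero W) W E where
  inverts := hW
  lift := liftPiZero
  fac F hF := rfl
  -- Objects of `π₀ Ho(A)` are those of `A` and each arrow is the class of an arrow of `A`, so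
  -- agreement on `A` suffices.
  uniq F₁ F₂ h := by
    refine CategoryTheory.Functor.ext (fun X => Functor.congr_obj h X.as.as) ?_
    rintro X Y ⟨f⟩
    exact Functor.congr_hom h f.as

/-- The strict universal property is needed for two targets only: the constructed localization of
`A` and `π₀ Ho(A)` itself. -/
theorem isLocalization_inclPiZero (hW : W.IsInvertedBy (inclPiZero W)) :
    (inclPiZero W).IsLocalization W :=
  .mk' _ _ (strictUniversalPropertyInclPiZero hW _) (strictUniversalPropertyInclPiZero hW _)

end PiZeroHo

/-! ### Fibrant-cofibrant objects -/

section ModelCategory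

variable {C : Type u} [Category.{v} C] [ModelCategory C]

/-- A homotopy in `C_fc` requires a cylinder object that is itself fibrant and cofibrant, hence the
passage to a very good cylinder. -/
theorem exists_homotopy_of_homRel {X Y : BifibrantObject C} {f g : X ⟶ Y}
    (h : BifibrantObject.homRel C f g) :
    Nonempty (Homotopy (bifibrantWeakEquivalences C) f g) := by
  rw [BifibrantObject.homRel_iff_leftHomotopyRel] at h
  obtain ⟨P, _, ⟨h⟩⟩ := h.exists_very_good_cylinder
  -- `P.I` is cofibrant because `X` is and `P.i₀` is a cofibration; it is fibrant because `X` is and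
  -- `P.π` is a fibration.
  have := isCofibrant_of_cofibration P.i₀
  have := isFibrant_of_fibration P.π
  exact ⟨{
    C := {
      cyl := .mk P.I
      base := X
      d₀ := ObjectProperty.homMk P.i₀
      d₁ := ObjectProperty.homMk P.i₁
      s := ObjectProperty.homMk P.π
      x := 𝟙 X
      hs := (weakEquivalence_iff P.π).1 inferInstance
      d₀_s := by ext; exact P.i₀_π
      d₁_s := by ext; exact P.i₁_π }
    h := ObjectProperty.homMk h.h
    d₀_h := by ext; exact h.h₀
    d₁_h := by ext; exact h.h₁ }⟩

/-- A functor on `C_fc` inverts weak equivalences exactly when it identifies homotopic arrows; a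
model-categorical homotopy supplies a 2-cell, which `π₀` collapses. -/
theorem inclPiZero_inverts :
    (bifibrantWeakEquivalences C).IsInvertedBy (inclPiZero (bifibrantWeakEquivalences C)) :=
  (BifibrantObject.inverts_iff_factors _).2 fun _ _ _ _ h =>
    (exists_homotopy_of_homRel h).some.inclPiZero_map_eq

instance : (inclPiZero (bifibrantWeakEquivalences C)).IsLocalization
    (bifibrantWeakEquivalences C) :=
  isLocalization_inclPiZero inclPiZero_inverts

/-! ### Comparison of `C` with its fibrant-cofibrant objects -/

variable
  (φ : MorphismProperty.FunctorialFactorizationData (cofibrations C) (trivialFibrations C))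
  (ψ : MorphismProperty.FunctorialFactorizationData (trivialCofibrations C) (fibrations C))

/-- The natural trivial fibration `Q X ⟶ X`. -/
noncomputable def cofibrantReplacementπ : cofibrantReplacement φ ⟶ 𝟭 C :=
  Functor.whiskerLeft initialArrow φ.p

/-- The natural trivial cofibration `X ⟶ R X`. -/
noncomputable def fibrantReplacementι : 𝟭 C ⟶ fibrantReplacement ψ :=
  Functor.whiskerLeft terminalArrow ψ.i

/-- In the localized category, a functor is isomorphic to its fibrant-cofibrant replacement. -/
theorem nonempty_iso_bifibrantReplacement {D : Type*} [Category* D] (L : C ⥤ D)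
    (hL : (weakEquivalences C).IsInvertedBy L) :
    Nonempty (L ≅ bifibrantReplacement φ ψ ⋙ BifibrantObject.ι ⋙ L) := by
  let α := Functor.whiskerRight (cofibrantReplacementπ φ) L
  let β := Functor.whiskerLeft (cofibrantReplacement φ)
    (Functor.whiskerRight (fibrantReplacementι ψ) L)
  -- The second component of being a trivial fibration, or a trivial cofibration below, is being a
  -- weak equivalence.
  have (X : C) : IsIso (α.app X) := hL _ (φ.hp (Arrow.mk (initial.to X))).2
  have (X : C) : IsIso (β.app X) := hL _ (ψ.hi (Arrow.mk (terminal.from _))).2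
  have : IsIso α := NatIso.isIso_of_isIso_app α
  have : IsIso β := NatIso.isIso_of_isIso_app β
  let a := asIso α
  let b := asIso β
  exact ⟨L.leftUnitor.symm ≪≫ a.symm ≪≫
    Functor.isoWhiskerLeft (cofibrantReplacement φ) L.leftUnitor.symm ≪≫ b⟩

instance : (piZeroLocFunctor φ ψ).IsLocalization (weakEquivalences C) := by
  let W := bifibrantWeakEquivalences C
  let P := inclPiZero W
  let L := (weakEquivalences C).Q
  -- Restricting the localization of `C` to `C_fc` is again a localization, so it must agree with
  -- `π₀ Ho(C_fc)` up to the equivalence `e`.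
  have : (BifibrantObject.ι ⋙ L).IsLocalization W :=
    inferInstanceAs ((BifibrantObject.ι ⋙ L).IsLocalization (weakEquivalences _))
  let e : PiZero (Ho W) ≌ (weakEquivalences C).Localization :=
    Localization.uniq P (BifibrantObject.ι ⋙ L) W
  obtain ⟨i⟩ := nonempty_iso_bifibrantReplacement φ ψ L (weakEquivalences C).Q_inverts
  -- `L` is isomorphic to its restriction to `C_fc` precomposed with `r`, and that restriction
  -- factors through `P` followed by `e`.
  let j : L ≅ piZeroLocFunctor φ ψ ⋙ e.functor :=
    i ≪≫ Functor.isoWhiskerLeft (bifibrantReplacement φ ψ)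
      (Localization.compUniqFunctor P (BifibrantObject.ι ⋙ L) W).symm
  exact Functor.IsLocalization.of_equivalence_target L (weakEquivalences C) _ e.symm
    (Functor.isoWhiskerRight j e.inverse ≪≫
      Functor.isoWhiskerLeft (piZeroLocFunctor φ ψ) e.unitIso.symm ≪≫ Functor.rightUnitor _)

end ModelCategory

end TwoLoc

theorem mainTheorem6 {C : Type u} [Category.{v} C] [ModelCategory C]
    (φ : MorphismProperty.FunctorialFactorizationData (cofibrations C) (trivialFibrations C))
    (ψ : MorphismProperty.FunctorialFactorizationData (trivialCofibrations C) (fibrations C)) :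
    ∃ hq : (weakEquivalences C).IsInvertedBy (TwoLoc.piZeroLocFunctor φ ψ),
      (∀ (X : Type u') [Category.{v'} X],
        (TwoLoc.precompInverting (TwoLoc.piZeroLocFunctor φ ψ) (weakEquivalences C) hq
          X).IsEquivalence) ∧
      ∃ e : (weakEquivalences C).Localization ≌
          TwoLoc.PiZero (TwoLoc.Ho (TwoLoc.bifibrantWeakEquivalences C)),
        Nonempty ((weakEquivalences C).Q ⋙ e.functor ≅ TwoLoc.piZeroLocFunctor φ ψ) := by
  exact ⟨Localization.inverts _ _,
    -- `precompInverting` is definitionally the precomposition functor attached to a localization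
    -- functor.
    fun X _ => inferInstanceAs
      (Localization.whiskeringLeftFunctor (TwoLoc.piZeroLocFunctor φ ψ) _ X).IsEquivalence,
    Localization.equivalenceFromModel _ _,
    ⟨Localization.qCompEquivalenceFromModelFunctorIso _ _⟩⟩
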